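/- Let $\mathscr W$ be the space of continuous functions $w:[0,1]\to\mathbb R$ with $w(0)=0$, with the Borel $\sigma$-field of the topology of uniform convergence, let $\gamma$ be the Wiener measure on $\mathscr W$ (under $\gamma$ the process $w\mapsto w(t)$, $0\le t\le 1$, is a centred Gaussian process with covariance $\min(s,t)$), and let $E$ denote the expectation with respect to $\gamma$. Let $\mathscr H\subset\mathscr W$ be the Cameron--Martin space of the absolutely continuous $h\in\mathscr W$ with $\int_0^1\dot h(t)^2\,dt<\infty$. For $h\in\mathscr H$ let $$[h](w)=\int_0^1\dot h(t)\,dw(t):=\lim_{n\to\infty}\sum_{k=0}^{2^n-1}\Big(2^n\int_{k2^{-n}}^{(k+1)2^{-n}}\dot h(t)\,dt\Big)\big(w((k+1)2^{-n})-w(k2^{-n})\big),$$ with $[h](w):=0$ for those $w$ for which the limit does not exist. A function $F:\mathscr W\to\mathbb R$ is a polynomial functional, written $F\in\mathbf P$, if there are $n\in\mathbb N$, $h_1,\dots,h_n\in\mathscr H$ and a real polynomial $p$ in $n$ variables with $F(w)=p([h_1](w),\dots,[h_n](w))$ for all $w\in\mathscr W$. For $\theta\in\mathscr H$, $F,G\in\mathbf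 P$ and $w\in\mathscr W$ put $$D_\theta F(w):=\lim_{\varepsilon\to0}\frac{F(w+\varepsilon\theta)-F(w)}{\varepsilon},\qquad D_\theta^*G(w):=-D_\theta G(w)+\int_0^1\dot\theta(t)\,dw(t)\cdot G(w).$$ Then, for every $h\in\mathscr H$, the limit defining $[h]$ exists $\gamma$-almost surely and in $L^2(\gamma)$, so that $[h]$ is a version of the Wiener integral. For all $\theta\in\mathscr H$ and $F,G\in\mathbf P$ the derivatives $D_\theta F(w)$ and $D_\theta G(w)$ exist for every $w\in\mathscr W$, the random variables $D_\theta F\cdot G$ and $F\cdot D_\theta^*G$ are $\gamma$-integrable, and $$E[D_\theta F\cdot G]=E[F\cdot D_\theta^*G].$$ -/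

import Mathlib

open MeasureTheory ProbabilityTheory Filter Topology

noncomputable section

namespace Wiener

/-- The path space `𝒲`: continuous real paths on `[0,1]` starting from zero, with the topology of
uniform convergence (the sup norm inherited from `C([0,1], ℝ)`). -/
def PathSpace : Submodule ℝ C(unitInterval, ℝ) where
  carrier := {w | w 0 = 0}
  add_mem' := by
    intro a b ha hb
    simp only [Set.mem_ofPred_eq] at ha hb ⊢
    simp [ha, hb]
  zero_mem' := by simp
  smul_mem' := by
    intro c a ha
    simp only [Set.mem_ofPred_eq] at ha ⊢
    simp [ha]

/-- The Borel `σ`-field of the topology of uniform convergence. -/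
instance : MeasurableSpace PathSpace := borel PathSpace

instance : BorelSpace PathSpace := ⟨rfl⟩

/-- `γ` is the Wiener measure on `𝒲`: under `γ` the canonical process `W(t, w) = w(t)`,
`0 ≤ t ≤ 1`, is a centred Gaussian process with covariance `E[W(s) W(t)] = min s t`. -/
structure IsWienerMeasure (γ : Measure PathSpace) : Prop where
  isProbabilityMeasure : IsProbabilityMeasure γ
  isGaussianProcess : IsGaussianProcess (fun (t : unitInterval) (w : PathSpace) => w.1 t) γ
  mean : ∀ t : unitInterval, ∫ w : PathSpace, w.1 t ∂γ = 0
  covariance : ∀ s t : unitInterval,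
    ∫ w : PathSpace, w.1 s * w.1 t ∂γ = min (s : ℝ) (t : ℝ)

/-- A path as a function on `ℝ`: it is `w` on `[0,1]`, and constant on either side. -/
def ext (w : PathSpace) : ℝ → ℝ := Set.IccExtend zero_le_one w.1

/-- The derivative `ḣ` (meaningful at almost every time in `[0,1]` if `h` is absolutely
continuous). -/
def dot (h : PathSpace) : ℝ → ℝ := deriv (ext h)

/-- The Cameron--Martin subspace `ℋ`: the paths `h ∈ 𝒲` that are absolutely continuous on `[0,1]`
and whose derivative is square-integrable. -/
def CameronMartin : Set PathSpace :=
  {h | AbsolutelyContinuousOnInterval (ext h) 0 1 ∧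
    MemLp (dot h) 2 (volume.restrict (Set.Icc 0 1))}

/-- The point `k / 2 ^ n` of the `n`-th dyadic partition of `[0,1]`. -/
def dyadic (n k : ℕ) : ℝ := (k : ℝ) / 2 ^ n

/-- The integral `∫₀¹ ḣₙ(t) dw(t)` of the step function `ḣₙ` which on each interval of the `n`-th
dyadic partition equals the average of `ḣ` over that interval
(`ḣₙ` is the orthogonal projection of `ḣ` in `L²[0,1]`, and `ḣₙ → ḣ` in `L²[0,1]`). -/
def stepIntegral (h : PathSpace) (n : ℕ) (w : PathSpace) : ℝ :=
  ∑ k ∈ Finset.range (2 ^ n),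
    (2 ^ n * ∫ t in dyadic n k..dyadic n (k + 1), dot h t) *
      (ext w (dyadic n (k + 1)) - ext w (dyadic n k))

open Classical in
/-- The Wiener integral `[h](w) = ∫₀¹ ḣ(t) dw(t)` as a function on `𝒲`: the limit of the integrals
of the dyadic step approximations of `ḣ`, and `0` at the paths where there is no limit.
For `h ∈ ℋ` the limit exists for almost every `w` under the Wiener measure, as well as in `L²`, so
that this is a version of the usual Wiener integral. The set of the paths with a limit is a linear
space that contains `ℋ`, so that the directional derivatives along `ℋ` make sense pointwise. -/
def wienerIntegral (h : PathSpace) (w : PathSpace) : ℝ :=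
  if hL : ∃ L : ℝ, Tendsto (fun n => stepIntegral h n w) atTop (𝓝 L) then hL.choose else 0

/-- The set `𝐏` of polynomial functionals `F(w) = p([h₁](w), …, [hₙ](w))`, with `hᵢ ∈ ℋ` and `p` a
real polynomial in `n` variables. -/
def PolynomialFunctional : Set (PathSpace → ℝ) :=
  {F | ∃ (n : ℕ) (h : Fin n → PathSpace) (p : MvPolynomial (Fin n) ℝ),
    (∀ i, h i ∈ CameronMartin) ∧
      ∀ w, F w = MvPolynomial.eval (fun i => wienerIntegral (h i) w) p}

/-- The directional derivative `D_θ F(w) = lim_{ε → 0} (F(w + ε θ) - F(w)) / ε`. -/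
def D (θ : PathSpace) (F : PathSpace → ℝ) (w : PathSpace) : ℝ := lineDeriv ℝ F w θ

/-- The formal adjoint `D_θ^* F(w) = - D_θ F(w) + ∫₀¹ θ̇(t) dw(t) · F(w)`. -/
def Dstar (θ : PathSpace) (F : PathSpace → ℝ) (w : PathSpace) : ℝ :=
  - D θ F w + wienerIntegral θ w * F w

end Wiener

end

/-! Write `I_n(h)` for the dyadic step integral `stepIntegral h n`. Everything rests on a
reproducing identity: `E[w(t) I_n(h)] = h(t)` at dyadic points `t` of level `n`, hence by linearity
`E[I_m(k) I_n(h)] = I_m(k)(h)` for `m ≤ n` and `h ∈ ℋ` (`integral_stepIntegral_mul_stepIntegral`).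

With `k = h` it says that `I_n(h)` has orthogonal increments. Being Gaussian, it is a martingale,
and by Cauchy–Schwarz its second moments are at most `∫ ḣ²`; so it converges almost surely and in
`L²`, and the limits `[h]` form a centred Gaussian process. With `m = n` it says that `I_n(h)(k) =
E[I_n(h) I_n(k)]`, which converges to `E[[h][k]]`. So the pathwise limit exists at every
Cameron–Martin path, and `[h](w + εθ) = [h](w) + ε E[[h][θ]]` wherever `[h](w)` is a genuine limit.
Elsewhere `[h]` vanishes on the whole line `w + εθ`.

Thus `D_θ` acts almost surely as a derivation on polynomials in the `[h_i]`, and the duality formula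
becomes `E[D_θ(FG)] = E[[θ] F G]`. This is Gaussian integration by parts
(`IsGaussianProcess.integral_mul_eval`), obtained by regressing the `[h_i]` on `[θ]` and integrating
by parts in one variable. -/

/-! ### Limits of Gaussian variables and processes -/

section GaussianLimits

variable {Ω : Type*} {mΩ : MeasurableSpace Ω} {P : Measure Ω}

/-- An almost everywhere limit of centred Gaussian variables with convergent variances is
Gaussian. -/
theorem map_eq_gaussianReal_of_tendsto_ae {Z : ℕ → Ω → ℝ} {Y : Ω → ℝ} {V : ℝ}
    (hZ : ∀ n, HasGaussianLaw (Z n) P) (hmean : ∀ n, ∫ ω, Z n ω ∂P = 0)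
    (hvar : Tendsto (fun n => ∫ ω, Z n ω * Z n ω ∂P) atTop (𝓝 V))
    (hlim : ∀ᵐ ω ∂P, Tendsto (fun n => Z n ω) atTop (𝓝 (Y ω))) :
    P.map Y = gaussianReal 0 V.toNNReal := by
  have : IsProbabilityMeasure P := (hZ 0).isProbabilityMeasure
  have hYm : AEMeasurable Y P :=
    aemeasurable_of_tendsto_metrizable_ae atTop (fun n => (hZ n).aemeasurable) hlim
  have hV : 0 ≤ V := ge_of_tendsto' hvar fun n => integral_nonneg fun ω => mul_self_nonneg _
  have : IsProbabilityMeasure (P.map Y) := P.isProbabilityMeasure_map hYm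
  apply Measure.ext_of_charFun
  ext t
  have h1 : ∀ {X : Ω → ℝ}, AEMeasurable X P →
      charFun (P.map X) t = ∫ ω, Complex.exp (t * X ω * Complex.I) ∂P := by
    intro X hX
    rw [charFun_apply_real, integral_map hX (by fun_prop)]
  have h2 : Tendsto (fun n => charFun (P.map (Z n)) t) atTop (𝓝 (charFun (P.map Y) t)) := by
    rw [h1 hYm]
    simp_rw [h1 (hZ _).aemeasurable]
    refine tendsto_integral_of_dominated_convergence (fun _ => 1) (fun n => ?_)
      (integrable_const _) (fun n => ?_) ?_
    · have := (hZ n).aemeasurable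
      exact AEMeasurable.aestronglyMeasurable (by fun_prop)
    · refine ae_of_all _ fun ω => ?_
      rw [← Complex.ofReal_mul, Complex.norm_exp_ofReal_mul_I]
    · filter_upwards [hlim] with ω hω
      have hc : Continuous fun x : ℝ => Complex.exp (t * x * Complex.I) := by fun_prop
      exact (hc.tendsto _).comp hω
  refine tendsto_nhds_unique h2 ?_
  have h3 : ∀ n, charFun (P.map (Z n)) t
      = Complex.exp (-((∫ ω, Z n ω * Z n ω ∂P : ℝ) : ℂ) * t ^ 2 / 2) := by
    intro n
    have hv : Var[Z n; P] = ∫ ω, Z n ω * Z n ω ∂P := by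
      rw [variance_of_integral_eq_zero (hZ n).aemeasurable (hmean n)]
      simp [pow_two]
    rw [(hZ n).map_eq_gaussianReal, charFun_gaussianReal, hv, hmean n,
      Real.coe_toNNReal _ (integral_nonneg fun ω => mul_self_nonneg _)]
    congr 1
    push_cast
    ring
  simp_rw [h3]
  rw [charFun_gaussianReal, Real.coe_toNNReal _ hV]
  have hc : Continuous fun x : ℝ => Complex.exp (-(x : ℂ) * t ^ 2 / 2) := by fun_prop
  convert! (hc.tendsto _).comp hvar using 2
  push_cast
  congr 1
  ring

/-- An almost everywhere limit of centred Gaussian processes with convergent covariances is a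
Gaussian process. -/
theorem isGaussianProcess_of_tendsto_ae {T : Type*} {X : ℕ → T → Ω → ℝ} {Y : T → Ω → ℝ}
    {K : T → T → ℝ} (hX : ∀ n, IsGaussianProcess (X n) P)
    (hmean : ∀ n t, ∫ ω, X n t ω ∂P = 0)
    (hcov : ∀ s t, Tendsto (fun n => ∫ ω, X n s ω * X n t ω ∂P) atTop (𝓝 (K s t)))
    (hlim : ∀ t, ∀ᵐ ω ∂P, Tendsto (fun n => X n t ω) atTop (𝓝 (Y t ω))) :
    IsGaussianProcess Y P := by
  classical
  have hYm : ∀ t, AEMeasurable (Y t) P := fun t =>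
    aemeasurable_of_tendsto_metrizable_ae atTop (fun n => (hX n).aemeasurable t) (hlim t)
  have hL2 : ∀ n t, MemLp (X n t) 2 P := fun n t => ((hX n).hasGaussianLaw_eval t).memLp_two
  have hP := (hX 0).isProbabilityMeasure
  refine ⟨fun I => ⟨isGaussian_of_map_eq_gaussianReal fun L => ?_⟩⟩
  obtain ⟨c, hLs⟩ : ∃ c : I → ℝ, ∀ x : I → ℝ, L x = ∑ i, x i * c i :=
    ⟨_, fun x => LinearMap.pi_apply_eq_sum_univ L.toLinearMap x⟩
  -- It is enough that each linear functional `L` has a Gaussian law; its variance is the quadratic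
  -- form of `K` at the coefficients `c` of `L`.
  refine ⟨0, Real.toNNReal (∑ i : I, ∑ j : I,
    c i * c j * K i j), ?_⟩
  have hYI : AEMeasurable (fun ω => I.restrict (Y · ω)) P :=
    aemeasurable_pi_lambda _ fun i => hYm i
  rw [AEMeasurable.map_map_of_aemeasurable L.continuous.measurable.aemeasurable hYI]
  refine map_eq_gaussianReal_of_tendsto_ae (Z := fun n ω => L (I.restrict (X n · ω)))
    (fun n => ((hX n).hasGaussianLaw I).map_fun L) (fun n => ?_) ?_ ?_
  · simp_rw [hLs, Finset.restrict]
    rw [integral_finsetSum _ fun (i : I) _ => ((hL2 n i).integrable (by norm_num)).mul_const _]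
    simp only [integral_mul_const, hmean, zero_mul, Finset.sum_const_zero]
  · have h1 : ∀ n, ∫ ω, L (I.restrict (X n · ω)) * L (I.restrict (X n · ω)) ∂P
        = ∑ i : I, ∑ j : I, c i * c j
          * ∫ ω, X n i ω * X n j ω ∂P := by
      intro n
      have hint : ∀ i j : I, Integrable (fun ω => X n i ω * c i
          * (X n j ω * c j)) P := fun i j =>
        ((hL2 n i).mul_const _).integrable_mul ((hL2 n j).mul_const _)
      simp_rw [hLs, Finset.sum_mul_sum, Finset.restrict]
      rw [integral_finsetSum _ fun i _ => integrable_finsetSum _ fun j _ => hint i j]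
      refine Finset.sum_congr rfl fun i _ => ?_
      rw [integral_finsetSum _ fun j _ => hint i j]
      refine Finset.sum_congr rfl fun j _ => ?_
      rw [← integral_const_mul]
      exact integral_congr_ae (ae_of_all _ fun ω => by ring)
    simp_rw [h1]
    exact tendsto_finsetSum _ fun i _ => tendsto_finsetSum _ fun j _ => (hcov i j).const_mul _
  · have : ∀ᵐ ω ∂P, ∀ i : I, Tendsto (fun n => X n i ω) atTop (𝓝 (Y i ω)) :=
      ae_all_iff.2 fun i => hlim i
    filter_upwards [this] with ω hω
    exact (L.continuous.tendsto _).comp (tendsto_pi_nhds.2 hω)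

/-- Convergence of `L²` inner products along `L²`-convergent sequences. -/
theorem tendsto_integral_mul_of_tendsto_eLpNorm {f g : ℕ → Ω → ℝ} {F G : Ω → ℝ}
    (hf : ∀ n, MemLp (f n) 2 P) (hg : ∀ n, MemLp (g n) 2 P) (hF : MemLp F 2 P) (hG : MemLp G 2 P)
    (hfF : Tendsto (fun n => eLpNorm (fun ω => f n ω - F ω) 2 P) atTop (𝓝 0))
    (hgG : Tendsto (fun n => eLpNorm (fun ω => g n ω - G ω) 2 P) atTop (𝓝 0)) :
    Tendsto (fun n => ∫ ω, f n ω * g n ω ∂P) atTop (𝓝 (∫ ω, F ω * G ω ∂P)) := by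
  have key : ∀ {u v : Ω → ℝ} (hu : MemLp u 2 P) (hv : MemLp v 2 P),
      ∫ ω, u ω * v ω ∂P = inner ℝ (hu.toLp u) (hv.toLp v) := by
    intro u v hu hv
    rw [L2.inner_def]
    refine integral_congr_ae ?_
    filter_upwards [hu.coeFn_toLp, hv.coeFn_toLp] with ω h1 h2
    simp [h1, h2, mul_comm]
  rw [key hF hG]
  simp_rw [fun n => key (hf n) (hg n)]
  exact ((Lp.tendsto_Lp_iff_tendsto_eLpNorm'' f hf F hF).2 hfF).inner
    ((Lp.tendsto_Lp_iff_tendsto_eLpNorm'' g hg G hG).2 hgG)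

theorem eLpNorm_two_eq_ofReal_sqrt {f : Ω → ℝ} (hf : MemLp f 2 P) :
    eLpNorm f 2 P = ENNReal.ofReal (√(∫ ω, f ω * f ω ∂P)) := by
  rw [hf.eLpNorm_eq_integral_rpow_norm (by norm_num) (by norm_num), Real.sqrt_eq_rpow]
  simp [pow_two]

end GaussianLimits

/-! ### Gaussian sequences with orthogonal increments -/

section GaussianMartingale

variable {Ω : Type*} {mΩ : MeasurableSpace Ω} {P : Measure Ω} {X : ℕ → Ω → ℝ}

/-- A centred Gaussian sequence with orthogonal increments is a martingale. -/
theorem ProbabilityTheory.IsGaussianProcess.martingale_natural (hX : IsGaussianProcess X P)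
    (hXm : ∀ n, StronglyMeasurable (X n)) (hmean : ∀ n, ∫ ω, X n ω ∂P = 0)
    (hcov : ∀ m n, m ≤ n → ∫ ω, X m ω * X n ω ∂P = ∫ ω, X m ω * X m ω ∂P) :
    Martingale X (Filtration.natural X hXm) P := by
  have := hX.isProbabilityMeasure
  have hL2 : ∀ n, MemLp (X n) 2 P := fun n => (hX.hasGaussianLaw_eval n).memLp_two
  have hint : ∀ n, Integrable (X n) P := fun n => (hL2 n).integrable (by norm_num)
  refine martingale_of_condExp_sub_eq_zero_nat (Filtration.stronglyAdapted_natural hXm) hint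
    fun i => ?_
  have hd : ∫ ω, (X (i + 1) - X i) ω ∂P = 0 := by
    simp only [Pi.sub_apply]
    rw [integral_sub (hint _) (hint _), hmean, hmean, sub_zero]
  -- For jointly Gaussian variables, orthogonality of the increment to the past is independence, so
  -- its conditional expectation is its mean, zero. The index `Unit` turns the increment into a
  -- process.
  have hindep : IndepFun (fun ω (_ : Unit) => (X (i + 1) - X i) ω)
      (fun ω (j : Set.Iic i) => X j ω) P := by
    refine IsGaussianProcess.indepFun_of_covariance_eq_zero
      (X := fun (_ : Unit) => X (i + 1) - X i) (Y := fun j : Set.Iic i => X j) ?_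
      (fun _ => ((hXm _).measurable.sub (hXm _).measurable).aemeasurable)
      (fun j => (hXm j).measurable.aemeasurable) ?_
    · classical
      refine hX.of_isGaussianProcess ?_
      rintro (_ | j)
      · exact ⟨{i, i + 1},
          (ContinuousLinearMap.proj (R := ℝ) (φ := fun _ => ℝ) ⟨i + 1, by simp⟩) -
            ContinuousLinearMap.proj (R := ℝ) (φ := fun _ => ℝ) ⟨i, by simp⟩, fun ω => rfl⟩
      · exact ⟨{j.1}, ContinuousLinearMap.proj (R := ℝ) (φ := fun _ => ℝ) ⟨j, by simp⟩,
          fun ω => rfl⟩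
    · rintro - ⟨j, hj⟩
      rw [Set.mem_Iic] at hj
      rw [covariance_eq_sub ((hL2 _).sub (hL2 _)) (hL2 j), hd, zero_mul, sub_zero]
      simp only [Pi.mul_apply, Pi.sub_apply, sub_mul]
      have hi : ∀ k, Integrable (fun ω => X k ω * X j ω) P :=
        fun k => (hL2 k).integrable_mul (hL2 j)
      rw [integral_sub (hi _) (hi _)]
      simp_rw [mul_comm _ (X j _)]
      rw [hcov j i hj, hcov j (i + 1) (hj.trans i.le_succ), sub_self]
  have h0 := condExp_indep_eq (f := X (i + 1) - X i) (μ := P)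
    (m₁ := MeasurableSpace.comap (fun ω (_ : Unit) => (X (i + 1) - X i) ω) inferInstance)
    (m₂ := MeasurableSpace.comap (fun ω (j : Set.Iic i) => X j ω) inferInstance)
    (Measurable.comap_le (measurable_pi_lambda _ fun _ =>
      (hXm _).measurable.sub (hXm _).measurable))
    (Measurable.comap_le (measurable_pi_lambda _ fun j => (hXm j).measurable)) ?_ hindep
  · rw [Filtration.natural_eq_comap]
    rw [hd] at h0
    exact h0
  · refine Measurable.stronglyMeasurable ?_
    exact (measurable_pi_apply ()).comp
      (comap_measurable (fun ω (_ : Unit) => (X (i + 1) - X i) ω))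

/-- An `L²`-bounded centred Gaussian sequence with orthogonal increments converges almost
everywhere. -/
theorem ProbabilityTheory.IsGaussianProcess.exists_ae_tendsto (hX : IsGaussianProcess X P)
    (hXm : ∀ n, StronglyMeasurable (X n)) (hmean : ∀ n, ∫ ω, X n ω ∂P = 0)
    (hcov : ∀ m n, m ≤ n → ∫ ω, X m ω * X n ω ∂P = ∫ ω, X m ω * X m ω ∂P)
    {C : ℝ} (hC : ∀ n, ∫ ω, X n ω * X n ω ∂P ≤ C) :
    ∀ᵐ ω ∂P, ∃ c, Tendsto (fun n => X n ω) atTop (𝓝 c) := by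
  have := hX.isProbabilityMeasure
  have hL2 : ∀ n, MemLp (X n) 2 P := fun n => (hX.hasGaussianLaw_eval n).memLp_two
  refine (hX.martingale_natural hXm hmean hcov).submartingale.exists_ae_tendsto_of_bdd
    (R := Real.toNNReal √C) fun n => ?_
  refine (eLpNorm_le_eLpNorm_of_exponent_le (by norm_num : (1 : ENNReal) ≤ 2)
    (hL2 n).aestronglyMeasurable).trans ?_
  rw [eLpNorm_two_eq_ofReal_sqrt (hL2 n)]
  exact ENNReal.ofReal_le_ofReal (Real.sqrt_le_sqrt (hC n))

/-- An `L²`-bounded sequence with orthogonal increments that converges almost everywhere converges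
in `L²`. -/
theorem tendsto_eLpNorm_of_orthogonal_increments {Y : Ω → ℝ} (hL2 : ∀ n, MemLp (X n) 2 P)
    (hcov : ∀ m n, m ≤ n → ∫ ω, X m ω * X n ω ∂P = ∫ ω, X m ω * X m ω ∂P)
    {C : ℝ} (hC : ∀ n, ∫ ω, X n ω * X n ω ∂P ≤ C)
    (hlim : ∀ᵐ ω ∂P, Tendsto (fun n => X n ω) atTop (𝓝 (Y ω))) :
    Tendsto (fun n => eLpNorm (fun ω => X n ω - Y ω) 2 P) atTop (𝓝 0) := by
  set c : ℕ → ℝ := fun n => ∫ ω, X n ω * X n ω ∂P with hc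
  have hdist : ∀ m n, m ≤ n →
      ∫ ω, (X m ω - X n ω) * (X m ω - X n ω) ∂P = c n - c m := by
    intro m n hmn
    have h1 : ∀ i j, Integrable (fun ω => X i ω * X j ω) P :=
      fun i j => (hL2 i).integrable_mul (hL2 j)
    have h2 : ∀ ω, (X m ω - X n ω) * (X m ω - X n ω)
        = X m ω * X m ω - 2 * (X m ω * X n ω) + X n ω * X n ω := fun ω => by ring
    have h3 : Integrable (fun ω => X m ω * X m ω - 2 * (X m ω * X n ω)) P :=
      (h1 m m).sub ((h1 m n).const_mul 2)
    simp_rw [h2]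
    rw [integral_add h3 (h1 n n), integral_sub (h1 m m) ((h1 m n).const_mul 2), integral_const_mul,
      hcov m n hmn]
    simp only [hc]
    ring
  have hmono : Monotone c := fun m n hmn => by
    have := hdist m n hmn
    have h0 : 0 ≤ ∫ ω, (X m ω - X n ω) * (X m ω - X n ω) ∂P :=
      integral_nonneg fun ω => mul_self_nonneg _
    linarith
  have hbdd : BddAbove (Set.range c) := ⟨C, by rintro _ ⟨n, rfl⟩; exact hC n⟩
  have hcl : Tendsto c atTop (𝓝 (⨆ n, c n)) := tendsto_atTop_ciSup hmono hbdd
  have hle : ∀ n, eLpNorm (fun ω => X n ω - Y ω) 2 P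
      ≤ ENNReal.ofReal (√((⨆ n, c n) - c n)) := by
    intro n
    -- Fatou's lemma in `m`: for `m ≥ n` the squared distance is `c m - c n`, at most `sup c - c n`.
    refine (Lp.eLpNorm_lim_le_liminf_eLpNorm (f := fun m ω => X n ω - X m ω)
      (fun m => ((hL2 n).sub (hL2 m)).aestronglyMeasurable) _ ?_).trans ?_
    · filter_upwards [hlim] with ω hω
      exact tendsto_const_nhds.sub hω
    · refine liminf_le_of_frequently_le' (Eventually.frequently ?_)
      filter_upwards [eventually_ge_atTop n] with m hm
      refine (eLpNorm_two_eq_ofReal_sqrt ((hL2 n).sub (hL2 m))).trans_le ?_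
      refine ENNReal.ofReal_le_ofReal (Real.sqrt_le_sqrt ?_)
      refine (hdist n m hm).trans_le ?_
      exact sub_le_sub_right (le_ciSup hbdd m) _
  refine tendsto_of_tendsto_of_tendsto_of_le_of_le tendsto_const_nhds ?_ (fun _ => zero_le) hle
  have h3 : Tendsto (fun n => √((⨆ n, c n) - c n)) atTop (𝓝 0) := by
    simpa using ((tendsto_const_nhds (x := ⨆ n, c n)).sub hcl).sqrt
  simpa using ENNReal.tendsto_ofReal h3

end GaussianMartingale

/-! ### Gaussian integration by parts -/

section Stein

open scoped NNReal

/-- Gaussian integration by parts on the real line. -/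
theorem integral_id_mul_gaussianReal {v : ℝ≥0} {f f' : ℝ → ℝ}
    (hderiv : ∀ x, HasDerivAt f (f' x) x) (hf : Integrable f (gaussianReal 0 v))
    (hxf : Integrable (fun x => x * f x) (gaussianReal 0 v))
    (hf' : Integrable f' (gaussianReal 0 v)) :
    ∫ x, x * f x ∂(gaussianReal 0 v) = v * ∫ x, f' x ∂(gaussianReal 0 v) := by
  rcases eq_or_ne v 0 with rfl | hv
  · simp [gaussianReal_zero_var]
  have hv' : (v : ℝ) ≠ 0 := by exact_mod_cast hv
  have hconv : ∀ {g : ℝ → ℝ}, Integrable g (gaussianReal 0 v) →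
      Integrable (fun x => gaussianPDFReal 0 v x * g x) := by
    intro g hg
    rw [gaussianReal_of_var_ne_zero _ hv, integrable_withDensity_iff_integrable_smul'
      (measurable_gaussianPDF _ _) (ae_of_all _ fun x => gaussianPDF_lt_top)] at hg
    simpa [toReal_gaussianPDF] using hg
  have hpdf : ∀ x, HasDerivAt (gaussianPDFReal 0 v) (-(x / v) * gaussianPDFReal 0 v x) x := by
    intro x
    have h1 : HasDerivAt (fun y : ℝ => -(y - 0) ^ 2 / (2 * v)) (-(x / v)) x := by
      have := ((((hasDerivAt_id x).sub_const 0).pow 2).neg).div_const (2 * (v : ℝ))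
      convert! this using 1
      simp
      field_simp
    have := (h1.exp).const_mul (√(2 * Real.pi * v))⁻¹
    convert! this using 1
    rw [gaussianPDFReal]
    ring
  -- The density `φ` satisfies `φ' = -(x / v) φ`, so `v φ f` has derivative `v φ f' - x φ f`.
  -- Integrability of both makes the integral of the derivative vanish, with no separate boundary
  -- estimate.
  have h0 := integral_eq_zero_of_hasDerivAt_of_integrable
    (f := fun x => v * (gaussianPDFReal 0 v x * f x))
    (f' := fun x => v * (gaussianPDFReal 0 v x * f' x) - gaussianPDFReal 0 v x * (x * f x))
    (fun x => by
      have := ((hpdf x).mul (hderiv x)).const_mul (v : ℝ)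
      convert! this using 1
      field_simp
      ring) (((hconv hf').const_mul _).sub (hconv hxf)) ((hconv hf).const_mul _)
  rw [integral_sub ((hconv hf').const_mul _) (hconv hxf), integral_const_mul] at h0
  rw [integral_gaussianReal_eq_integral_smul hv, integral_gaussianReal_eq_integral_smul hv]
  simp only [smul_eq_mul]
  linarith

theorem MvPolynomial.hasDerivAt_eval_add_mul {ι : Type*} [Fintype ι] (p : MvPolynomial ι ℝ)
    (y c : ι → ℝ) (x : ℝ) :
    HasDerivAt (fun t => MvPolynomial.eval (fun i => y i + t * c i) p)
      (∑ i, c i * MvPolynomial.eval (fun i => y i + x * c i) (MvPolynomial.pderiv i p)) x := by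
  classical
  induction p using MvPolynomial.induction_on with
  | C a => simpa using hasDerivAt_const x a
  | add p q hp hq =>
    convert! hp.add hq using 1
    · ext t; simp
    · simp [mul_add, Finset.sum_add_distrib]
  | mul_X p j hp =>
    have hj : HasDerivAt (fun t => y j + t * c j) (c j) x := by
      simpa using ((hasDerivAt_id x).mul_const (c j)).const_add (y j)
    convert! hp.mul hj using 1
    · ext t; simp
    · simp only [Derivation.leibniz, MvPolynomial.pderiv_X, smul_eq_mul, map_add, map_mul,
        MvPolynomial.eval_X, mul_add (c _), Finset.sum_add_distrib, Finset.sum_mul]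
      rw [add_comm]
      congr 1
      · exact Finset.sum_congr rfl fun i _ => by ring
      · rw [Finset.sum_eq_single j]
        · simp; ring
        · intro b _ hb
          simp [hb.symm]
        · simp

variable {Ω : Type*} {mΩ : MeasurableSpace Ω} {P : Measure Ω}

/-- Multiplying by a variable costs a factor two in the exponent by Hölder, so the induction has to
carry all finite exponents at once. -/
theorem memLp_eval_mvPolynomial [IsProbabilityMeasure P] {ι : Type*} {X : ι → Ω → ℝ}
    (hX : ∀ i (p : ENNReal), p ≠ ⊤ → MemLp (X i) p P) (q : MvPolynomial ι ℝ) :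
    ∀ p : ENNReal, p ≠ ⊤ → MemLp (fun ω => MvPolynomial.eval (fun i => X i ω) q) p P := by
  induction q using MvPolynomial.induction_on with
  | C a => intro p _; simpa using memLp_const a
  | add q r hq hr => intro p hp; simpa using! (hq p hp).add (hr p hp)
  | mul_X q j hq =>
    intro p hp
    simp only [map_mul, MvPolynomial.eval_X]
    have h2 : (2 : ENNReal) * p ≠ ⊤ := ENNReal.mul_ne_top (by norm_num) hp
    have : ENNReal.HolderTriple (2 * p) (2 * p) p := ⟨by
      rw [ENNReal.mul_inv (by simp) (by simp), ← add_mul, ENNReal.inv_two_add_inv_two, one_mul]⟩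
    exact (hX j _ h2).mul (hq _ h2)

/-- Gaussian integration by parts for polynomials in jointly Gaussian centred variables. -/
theorem ProbabilityTheory.IsGaussianProcess.integral_mul_eval {T : Type*} {X : T → Ω → ℝ}
    (hX : IsGaussianProcess X P) (hmean : ∀ t, ∫ ω, X t ω ∂P = 0) {ι : Type*} [Fintype ι]
    (s : T) (t : ι → T) (p : MvPolynomial ι ℝ) :
    ∫ ω, X s ω * MvPolynomial.eval (fun i => X (t i) ω) p ∂P
      = ∑ i, (∫ ω, X s ω * X (t i) ω ∂P) *
          ∫ ω, MvPolynomial.eval (fun i => X (t i) ω) (MvPolynomial.pderiv i p) ∂P := by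
  have := hX.isProbabilityMeasure
  have hLp : ∀ u (r : ENNReal), r ≠ ⊤ → MemLp (X u) r P := fun u r hr =>
    (hX.hasGaussianLaw_eval u).memLp hr
  have hL2 : ∀ u, MemLp (X u) 2 P := fun u => hLp u 2 (by norm_num)
  have hev : ∀ q : MvPolynomial ι ℝ,
      MemLp (fun ω => MvPolynomial.eval (fun i => X (t i) ω) q) 2 P := fun q =>
    memLp_eval_mvPolynomial (fun i r hr => hLp (t i) r hr) q 2 (by norm_num)
  set v : ℝ := ∫ ω, X s ω * X s ω ∂P with hv
  have hv0 : 0 ≤ v := integral_nonneg fun ω => mul_self_nonneg _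
  set c : ι → ℝ := fun i => (∫ ω, X s ω * X (t i) ω ∂P) with hc
  have hlaw : P.map (X s) = gaussianReal 0 v.toNNReal := by
    rw [(hX.hasGaussianLaw_eval s).map_eq_gaussianReal, hmean s,
      variance_of_integral_eq_zero (hX.aemeasurable s) (hmean s)]
    simp [hv, pow_two]
  -- If `X s` has variance zero it vanishes almost everywhere and both sides are zero; otherwise
  -- division by `v` is allowed.
  rcases eq_or_lt_of_le hv0 with hv0 | hv0
  · have hz : X s =ᵐ[P] 0 := by
      have := (integral_eq_zero_iff_of_nonneg (fun ω => mul_self_nonneg (X s ω))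
        ((hL2 s).integrable_mul (hL2 s))).1 hv0.symm
      filter_upwards [this] with ω hω
      simpa using hω
    have h0 : ∀ g : Ω → ℝ, ∫ ω, X s ω * g ω ∂P = 0 := by
      intro g
      rw [integral_eq_zero_of_ae]
      filter_upwards [hz] with ω hω
      simp [hω]
    simp [h0]
  -- The residual of the regression of `X (t i)` on `X s`: the coefficient `c i / v` makes it
  -- uncorrelated with `X s`, and joint Gaussianity makes the whole family independent of `X s`.
  set Y : ι → Ω → ℝ := fun i ω => X (t i) ω - c i / v * X s ω with hY
  have hYm : ∀ i, AEMeasurable (Y i) P := fun i =>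
    (hX.aemeasurable _).sub ((hX.aemeasurable s).const_mul _)
  have hYL2 : ∀ i, MemLp (Y i) 2 P := fun i => (hL2 _).sub ((hL2 s).const_mul _)
  have hindep : IndepFun (fun ω (_ : Unit) => X s ω) (fun ω i => Y i ω) P := by
    refine IsGaussianProcess.indepFun_of_covariance_eq_zero
      (X := fun (_ : Unit) => X s) (Y := Y) ?_ (fun _ => hX.aemeasurable s) hYm ?_
    · classical
      refine hX.of_isGaussianProcess ?_
      rintro (_ | i)
      · exact ⟨{s}, ContinuousLinearMap.proj (R := ℝ) (φ := fun _ => ℝ) ⟨s, by simp⟩,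
          fun ω => rfl⟩
      · exact ⟨{s, t i},
          (ContinuousLinearMap.proj (R := ℝ) (φ := fun _ => ℝ) ⟨t i, by simp⟩) -
            (c i / v) • ContinuousLinearMap.proj (R := ℝ) (φ := fun _ => ℝ) ⟨s, by simp⟩,
          fun ω => rfl⟩
    · rintro - i
      rw [covariance_eq_sub (hL2 s) (hYL2 i), hmean s, zero_mul, sub_zero]
      simp only [Pi.mul_apply, hY, mul_sub, mul_left_comm (X s _)]
      have hi : ∀ u, Integrable (fun ω => X s ω * X u ω) P :=
        fun u => (hL2 s).integrable_mul (hL2 u)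
      rw [integral_sub (hi _) ((hi s).const_mul _), integral_const_mul]
      change c i - c i / v * v = 0
      rw [div_mul_cancel₀ _ hv0.ne', sub_self]
  replace hindep : IndepFun (X s) (fun ω i => Y i ω) P :=
    hindep.comp (φ := fun x : Unit → ℝ => x ()) (ψ := id) (by fun_prop) measurable_id
  have hYvm : AEMeasurable (fun ω i => Y i ω) P := aemeasurable_pi_lambda _ hYm
  have hprod := (indepFun_iff_map_prod_eq_prod_map_map (hX.aemeasurable s) hYvm).1 hindep
  rw [hlaw] at hprod
  set ν := P.map (fun ω i => Y i ω) with hν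
  have : IsProbabilityMeasure ν := P.isProbabilityMeasure_map hYvm
  have hpair : AEMeasurable (fun ω => (X s ω, fun i => Y i ω)) P :=
    (hX.aemeasurable s).prodMk hYvm
  -- evaluation of a polynomial as a function of the independent pair
  let Φ : MvPolynomial ι ℝ → ℝ × (ι → ℝ) → ℝ := fun q z =>
    MvPolynomial.eval (fun i => z.2 i + z.1 * (c i / v)) q
  have hΦm : ∀ q, Continuous (Φ q) := fun q =>
    (MvPolynomial.continuous_eval q).comp (by fun_prop)
  have hΦ : ∀ q ω, Φ q (X s ω, fun i => Y i ω) = MvPolynomial.eval (fun i => X (t i) ω) q := by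
    intro q ω
    simp only [Φ, hY]
    congr 2
    ext i
    ring
  have htrans : ∀ g : ℝ × (ι → ℝ) → ℝ, Continuous g →
      Integrable (fun ω => g (X s ω, fun i => Y i ω)) P →
      Integrable g ((gaussianReal 0 v.toNNReal).prod ν) ∧
      ∫ ω, g (X s ω, fun i => Y i ω) ∂P = ∫ y, ∫ x, g (x, y) ∂(gaussianReal 0 v.toNNReal) ∂ν := by
    intro g hg hgi
    have h1 : Integrable g ((gaussianReal 0 v.toNNReal).prod ν) := by
      rw [← hprod, integrable_map_measure hg.measurable.aestronglyMeasurable hpair]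
      exact hgi
    refine ⟨h1, ?_⟩
    rw [← integral_prod_symm _ h1, ← hprod,
      integral_map hpair hg.measurable.aestronglyMeasurable]
  have hiΦ : ∀ q, Integrable (fun ω => Φ q (X s ω, fun i => Y i ω)) P := fun q => by
    simp_rw [hΦ]
    exact (hev q).integrable (by norm_num)
  have hixΦ := fun q => htrans (fun z => z.1 * Φ q z) (continuous_fst.mul (hΦm q)) (by
    simp_rw [hΦ]
    exact (hL2 s).integrable_mul (hev q))
  have hdΦ := htrans (fun z => ∑ i, c i / v * Φ (MvPolynomial.pderiv i p) z)
    (continuous_finsetSum _ fun i _ => continuous_const.mul (hΦm _))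
    (integrable_finsetSum _ fun i _ => (hiΦ _).const_mul _)
  have hlhs := (hixΦ p).2
  simp_rw [hΦ] at hlhs
  rw [hlhs]
  -- With the residuals frozen at `y`, the polynomial depends on `x` alone and the one-dimensional
  -- formula applies; Fubini supplies integrability of almost every section.
  have hstein : ∀ᵐ y ∂ν, ∫ x, x * Φ p (x, y) ∂(gaussianReal 0 v.toNNReal)
      = v * ∫ x, ∑ i, c i / v * Φ (MvPolynomial.pderiv i p) (x, y)
        ∂(gaussianReal 0 v.toNNReal) := by
    filter_upwards [(htrans (Φ p) (hΦm p) (hiΦ p)).1.prod_left_ae, (hixΦ p).1.prod_left_ae,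
      hdΦ.1.prod_left_ae] with y h1 h2 h3
    have := integral_id_mul_gaussianReal
      (fun x => MvPolynomial.hasDerivAt_eval_add_mul p y (fun i => c i / v) x) h1 h2 h3
    rwa [Real.coe_toNNReal _ hv0.le] at this
  rw [integral_congr_ae hstein, integral_const_mul, ← hdΦ.2,
    integral_finsetSum _ fun i _ => (hiΦ _).const_mul _, Finset.mul_sum]
  refine Finset.sum_congr rfl fun i _ => ?_
  rw [integral_const_mul]
  simp_rw [hΦ]
  rw [← mul_assoc, mul_div_cancel₀ _ hv0.ne']

end Stein

/-! ### Dyadic step integrals on path space -/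

namespace Wiener

variable {γ : Measure PathSpace} {h k θ w : PathSpace} {n m : ℕ}

theorem ext_add_smul (w θ : PathSpace) (c t : ℝ) : ext (w + c • θ) t = ext w t + c * ext θ t := rfl

theorem ext_zero (w : PathSpace) : ext w 0 = 0 := by
  have : ext w 0 = w.1 0 := Set.IccExtend_left zero_le_one _
  rw [this]
  exact w.2

theorem continuous_ext_apply (t : ℝ) : Continuous fun w : PathSpace => ext w t :=
  (continuous_eval_const (Set.projIcc 0 1 zero_le_one t)).comp continuous_subtype_val

theorem stepIntegral_add_smul (h w θ : PathSpace) (c : ℝ) (n : ℕ) :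
    stepIntegral h n (w + c • θ) = stepIntegral h n w + c * stepIntegral h n θ := by
  simp only [stepIntegral, ext_add_smul, Finset.mul_sum, ← Finset.sum_add_distrib]
  exact Finset.sum_congr rfl fun k _ => by ring

theorem continuous_stepIntegral (h : PathSpace) (n : ℕ) : Continuous (stepIntegral h n) :=
  continuous_finsetSum _ fun _ _ =>
    continuous_const.mul ((continuous_ext_apply _).sub (continuous_ext_apply _))

theorem dyadic_mem_Icc {k : ℕ} (hk : k ≤ 2 ^ n) : dyadic n k ∈ Set.Icc (0 : ℝ) 1 := by
  refine ⟨by unfold dyadic; positivity, ?_⟩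
  rw [dyadic, div_le_one (by positivity)]
  exact_mod_cast hk

theorem dyadic_le_dyadic {i j : ℕ} (hij : i ≤ j) : dyadic n i ≤ dyadic n j := by
  unfold dyadic
  gcongr

theorem dyadic_succ_sub (n k : ℕ) : dyadic n (k + 1) - dyadic n k = (2 ^ n)⁻¹ := by
  unfold dyadic
  push_cast
  ring

theorem dyadic_zero (n : ℕ) : dyadic n 0 = 0 := by simp [dyadic]

theorem dyadic_two_pow (n : ℕ) : dyadic n (2 ^ n) = 1 := by simp [dyadic]

theorem dyadic_refine (hmn : m ≤ n) (j : ℕ) : dyadic m j = dyadic n (j * 2 ^ (n - m)) := by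
  unfold dyadic
  have : (2 : ℝ) ^ n = 2 ^ m * 2 ^ (n - m) := by rw [← pow_add, Nat.add_sub_cancel' hmn]
  rw [this]
  push_cast
  field_simp

theorem uIcc_dyadic_subset {k : ℕ} (hk : k < 2 ^ n) :
    Set.uIcc (dyadic n k) (dyadic n (k + 1)) ⊆ Set.uIcc 0 1 := by
  rw [Set.uIcc_of_le zero_le_one]
  exact Set.uIcc_subset_Icc (dyadic_mem_Icc hk.le) (dyadic_mem_Icc hk)

theorem integral_dot_dyadic (hh : h ∈ CameronMartin) {k : ℕ} (hk : k < 2 ^ n) :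
    ∫ t in dyadic n k..dyadic n (k + 1), dot h t
      = ext h (dyadic n (k + 1)) - ext h (dyadic n k) :=
  (hh.1.mono (uIcc_dyadic_subset hk)).integral_deriv_eq_sub

/-! ### The Gaussian process of the step integrals -/

theorem isGaussianProcess_ext (hγ : IsWienerMeasure γ) :
    IsGaussianProcess (fun (t : ℝ) (w : PathSpace) => ext w t) γ :=
  hγ.isGaussianProcess.comp_right (Set.projIcc 0 1 zero_le_one)

theorem integral_ext (hγ : IsWienerMeasure γ) (t : ℝ) : ∫ w, ext w t ∂γ = 0 := hγ.mean _

theorem integral_ext_mul_ext (hγ : IsWienerMeasure γ) {s t : ℝ} (hs : s ∈ Set.Icc (0 : ℝ) 1)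
    (ht : t ∈ Set.Icc (0 : ℝ) 1) : ∫ w, ext w s * ext w t ∂γ = min s t := by
  have := hγ.covariance ⟨s, hs⟩ ⟨t, ht⟩
  simp only [ext, Set.IccExtend_of_mem zero_le_one _ hs, Set.IccExtend_of_mem zero_le_one _ ht]
  exact this

theorem memLp_ext (hγ : IsWienerMeasure γ) (t : ℝ) : MemLp (fun w => ext w t) 2 γ :=
  ((isGaussianProcess_ext hγ).hasGaussianLaw_eval t).memLp_two

/-- Joint indexing by path and level serves both uses: fixed `h` for the martingale in `n`, fixed
`n` for the limit process in `h`. -/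
theorem isGaussianProcess_stepIntegral_pair (hγ : IsWienerMeasure γ) :
    IsGaussianProcess (fun (q : PathSpace × ℕ) w => stepIntegral q.1 q.2 w) γ := by
  classical
  have hB := isGaussianProcess_ext hγ
  refine hB.of_isGaussianProcess fun q => ?_
  obtain ⟨h, n⟩ := q
  let I : Finset ℝ := (Finset.range (2 ^ n + 1)).image (dyadic n)
  have hI : ∀ k ≤ 2 ^ n, dyadic n k ∈ I := fun k hk =>
    Finset.mem_image_of_mem _ (Finset.mem_range.2 (Nat.lt_succ_of_le hk))
  refine ⟨I, ∑ k : Fin (2 ^ n), (2 ^ n * ∫ t in dyadic n k..dyadic n (k + 1), dot h t) •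
    (ContinuousLinearMap.proj (R := ℝ) (φ := fun _ : I => ℝ) ⟨_, hI (k + 1) k.2⟩
      - ContinuousLinearMap.proj (R := ℝ) (φ := fun _ : I => ℝ) ⟨_, hI k k.2.le⟩), fun w => ?_⟩
  simp [stepIntegral, Finset.sum_range]

theorem isGaussianProcess_stepIntegral (hγ : IsWienerMeasure γ) (n : ℕ) :
    IsGaussianProcess (fun (h : PathSpace) w => stepIntegral h n w) γ :=
  (isGaussianProcess_stepIntegral_pair hγ).comp_right (fun h => (h, n))

theorem memLp_stepIntegral (hγ : IsWienerMeasure γ) (h : PathSpace) (n : ℕ) :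
    MemLp (stepIntegral h n) 2 γ :=
  ((isGaussianProcess_stepIntegral hγ n).hasGaussianLaw_eval h).memLp_two

/-- The covariance of a linear combination of increments with another variable. -/
theorem integral_mul_stepIntegral (hγ : IsWienerMeasure γ) {f : PathSpace → ℝ} (hf : MemLp f 2 γ)
    (h : PathSpace) (n : ℕ) :
    ∫ w, f w * stepIntegral h n w ∂γ = ∑ k ∈ Finset.range (2 ^ n),
      (2 ^ n * ∫ t in dyadic n k..dyadic n (k + 1), dot h t) *
        (∫ w, f w * ext w (dyadic n (k + 1)) ∂γ - ∫ w, f w * ext w (dyadic n k) ∂γ) := by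
  have hi : ∀ t, Integrable (fun w => f w * ext w t) γ :=
    fun t => hf.integrable_mul (memLp_ext hγ t)
  have h1 : ∀ w, f w * stepIntegral h n w = ∑ k ∈ Finset.range (2 ^ n),
      (2 ^ n * ∫ t in dyadic n k..dyadic n (k + 1), dot h t) *
        (f w * ext w (dyadic n (k + 1)) - f w * ext w (dyadic n k)) := by
    intro w
    rw [stepIntegral, Finset.mul_sum]
    exact Finset.sum_congr rfl fun k _ => by ring
  simp_rw [h1]
  have hd : ∀ s t, Integrable (fun w => f w * ext w s - f w * ext w t) γ :=
    fun s t => (hi s).sub (hi t)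
  rw [integral_finsetSum _ fun k _ => (hd _ _).const_mul _]
  refine Finset.sum_congr rfl fun k _ => ?_
  rw [integral_const_mul, integral_sub (hi _) (hi _)]

theorem integral_stepIntegral (hγ : IsWienerMeasure γ) (h : PathSpace) (n : ℕ) :
    ∫ w, stepIntegral h n w ∂γ = 0 := by
  have := hγ.isProbabilityMeasure
  simpa [integral_ext hγ] using integral_mul_stepIntegral hγ (memLp_const (1 : ℝ)) h n

theorem integral_ext_mul_stepIntegral (hγ : IsWienerMeasure γ) (hh : h ∈ CameronMartin) {j : ℕ}
    (hj : j ≤ 2 ^ n) :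
    ∫ w, ext w (dyadic n j) * stepIntegral h n w ∂γ = ext h (dyadic n j) := by
  rw [integral_mul_stepIntegral hγ (memLp_ext hγ _)]
  -- Only increments before `dyadic n j` correlate with the path there; each covariance `2⁻ⁿ`
  -- cancels the factor `2ⁿ` of the average slope, leaving increments of `h` that telescope.
  have hterm : ∀ k ∈ Finset.range (2 ^ n),
      (2 ^ n * ∫ t in dyadic n k..dyadic n (k + 1), dot h t) *
        (∫ w, ext w (dyadic n j) * ext w (dyadic n (k + 1)) ∂γ
          - ∫ w, ext w (dyadic n j) * ext w (dyadic n k) ∂γ)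
      = if k < j then ext h (dyadic n (k + 1)) - ext h (dyadic n k) else 0 := by
    intro k hk
    rw [Finset.mem_range] at hk
    rw [integral_ext_mul_ext hγ (dyadic_mem_Icc hj) (dyadic_mem_Icc hk),
      integral_ext_mul_ext hγ (dyadic_mem_Icc hj) (dyadic_mem_Icc hk.le),
      integral_dot_dyadic hh hk]
    split_ifs with hkj
    · rw [min_eq_right (dyadic_le_dyadic hkj), min_eq_right (dyadic_le_dyadic hkj.le),
        dyadic_succ_sub]
      field_simp
    · rw [not_lt] at hkj
      rw [min_eq_left (dyadic_le_dyadic hkj), min_eq_left (dyadic_le_dyadic (hkj.trans k.le_succ))]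
      simp
  rw [Finset.sum_congr rfl hterm, ← Finset.sum_filter]
  have : (Finset.range (2 ^ n)).filter (· < j) = Finset.range j := by
    ext k
    simp only [Finset.mem_filter, Finset.mem_range]
    omega
  rw [this, Finset.sum_range_sub (fun k => ext h (dyadic n k)), dyadic_zero, ext_zero, sub_zero]

/-- The coarser integral is linear in path values at points of level `m`, which are also points of
level `n`, so the reproducing identity applies to each value. -/
theorem integral_stepIntegral_mul_stepIntegral (hγ : IsWienerMeasure γ) (hh : h ∈ CameronMartin)
    (k : PathSpace) (hmn : m ≤ n) :
    ∫ w, stepIntegral k m w * stepIntegral h n w ∂γ = stepIntegral k m h := by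
  simp_rw [mul_comm (stepIntegral k m _)]
  rw [integral_mul_stepIntegral hγ (memLp_stepIntegral hγ h n), stepIntegral]
  refine Finset.sum_congr rfl fun j hj => ?_
  have key : ∀ i ≤ 2 ^ m, ∫ w, stepIntegral h n w * ext w (dyadic m i) ∂γ = ext h (dyadic m i) := by
    intro i hi
    simp_rw [mul_comm (stepIntegral h n _)]
    rw [dyadic_refine hmn]
    refine integral_ext_mul_stepIntegral hγ hh ?_
    calc i * 2 ^ (n - m) ≤ 2 ^ m * 2 ^ (n - m) := Nat.mul_le_mul_right _ hi
      _ = 2 ^ n := by rw [← pow_add, Nat.add_sub_cancel' hmn]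
  rw [Finset.mem_range] at hj
  rw [key _ hj, key _ hj.le]

/-- The step approximations are bounded in `L²` by the norm of `ḣ`. -/
theorem stepIntegral_self_le (hh : h ∈ CameronMartin) (n : ℕ) :
    stepIntegral h n h ≤ ∫ t in (0 : ℝ)..1, dot h t ^ 2 := by
  have hsq : IntervalIntegrable (fun t => dot h t ^ 2) volume 0 1 := by
    rw [intervalIntegrable_iff_integrableOn_Icc_of_le zero_le_one]
    exact hh.2.integrable_sq
  have hdot : IntervalIntegrable (dot h) volume 0 1 := hh.1.intervalIntegrable_deriv
  have hsum := intervalIntegral.sum_integral_adjacent_intervals (a := dyadic n) (n := 2 ^ n)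
    (μ := volume) (f := fun t => dot h t ^ 2) fun k hk => hsq.mono_set (uIcc_dyadic_subset hk)
  rw [dyadic_zero, dyadic_two_pow] at hsum
  rw [← hsum, stepIntegral]
  refine Finset.sum_le_sum fun k hk => ?_
  rw [Finset.mem_range] at hk
  rw [← integral_dot_dyadic hh hk]
  have i1 := hdot.mono_set (uIcc_dyadic_subset hk)
  have i2 := hsq.mono_set (uIcc_dyadic_subset hk)
  set a := ∫ t in dyadic n k..dyadic n (k + 1), dot h t with ha
  -- Here `2 ^ n * a` is the mean of `ḣ` on the interval; expanding the square gives Cauchy–Schwarz,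
  -- `2ⁿ a² ≤ ∫ ḣ²`.
  have h0 : 0 ≤ ∫ t in dyadic n k..dyadic n (k + 1), (dot h t - 2 ^ n * a) ^ 2 :=
    intervalIntegral.integral_nonneg_of_forall (dyadic_le_dyadic k.le_succ) fun t => sq_nonneg _
  have h1 : ∀ t, (dot h t - 2 ^ n * a) ^ 2
      = dot h t ^ 2 - 2 * (2 ^ n * a) * dot h t + (2 ^ n * a) ^ 2 := fun t => by ring
  simp_rw [h1] at h0
  rw [intervalIntegral.integral_add (i2.sub (i1.const_mul _)) (by simp),
    intervalIntegral.integral_sub i2 (i1.const_mul _), intervalIntegral.integral_const_mul,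
    intervalIntegral.integral_const, dyadic_succ_sub, ← ha, smul_eq_mul] at h0
  have h2 : ((2 : ℝ) ^ n)⁻¹ * (2 ^ n * a) ^ 2 = 2 ^ n * a * a := by field_simp
  linarith

/-! ### The Wiener integral as a limit -/

theorem tendsto_wienerIntegral (hL : ∃ L, Tendsto (fun n => stepIntegral h n w) atTop (𝓝 L)) :
    Tendsto (fun n => stepIntegral h n w) atTop (𝓝 (wienerIntegral h w)) := by
  rw [wienerIntegral, dif_pos hL]
  exact hL.choose_spec

theorem integral_stepIntegral_mul_self (hγ : IsWienerMeasure γ) (hh : h ∈ CameronMartin)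
    (hmn : m ≤ n) :
    ∫ w, stepIntegral h m w * stepIntegral h n w ∂γ
      = ∫ w, stepIntegral h m w * stepIntegral h m w ∂γ := by
  rw [integral_stepIntegral_mul_stepIntegral hγ hh h hmn,
    integral_stepIntegral_mul_stepIntegral hγ hh h le_rfl]

theorem integral_stepIntegral_sq_le (hγ : IsWienerMeasure γ) (hh : h ∈ CameronMartin) (n : ℕ) :
    ∫ w, stepIntegral h n w * stepIntegral h n w ∂γ ≤ ∫ t in (0 : ℝ)..1, dot h t ^ 2 :=
  (integral_stepIntegral_mul_stepIntegral hγ hh h le_rfl).trans_le (stepIntegral_self_le hh n)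

theorem ae_tendsto_stepIntegral (hγ : IsWienerMeasure γ) (hh : h ∈ CameronMartin) :
    ∀ᵐ w ∂γ, Tendsto (fun n => stepIntegral h n w) atTop (𝓝 (wienerIntegral h w)) := by
  have hX : IsGaussianProcess (stepIntegral h) γ :=
    (isGaussianProcess_stepIntegral_pair hγ).comp_right (fun n => (h, n))
  filter_upwards [hX.exists_ae_tendsto
    (fun n => (continuous_stepIntegral h n).measurable.stronglyMeasurable)
    (integral_stepIntegral hγ h) (fun m n => integral_stepIntegral_mul_self hγ hh)
    (integral_stepIntegral_sq_le hγ hh)] with w hw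
  exact tendsto_wienerIntegral hw

theorem tendsto_eLpNorm_stepIntegral (hγ : IsWienerMeasure γ) (hh : h ∈ CameronMartin) :
    Tendsto (fun n => eLpNorm (fun w => stepIntegral h n w - wienerIntegral h w) 2 γ)
      atTop (𝓝 0) :=
  tendsto_eLpNorm_of_orthogonal_increments (memLp_stepIntegral hγ h)
    (fun _ _ => integral_stepIntegral_mul_self hγ hh) (integral_stepIntegral_sq_le hγ hh)
    (ae_tendsto_stepIntegral hγ hh)

theorem memLp_two_wienerIntegral (hγ : IsWienerMeasure γ) (hh : h ∈ CameronMartin) :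
    MemLp (wienerIntegral h) 2 γ := by
  have hm : AEStronglyMeasurable (wienerIntegral h) γ :=
    aestronglyMeasurable_of_tendsto_ae atTop
      (fun n => (memLp_stepIntegral hγ h n).aestronglyMeasurable) (ae_tendsto_stepIntegral hγ hh)
  obtain ⟨n, hn⟩ := ((tendsto_eLpNorm_stepIntegral hγ hh).eventually
    (gt_mem_nhds ENNReal.zero_lt_top)).exists
  have h1 : MemLp (fun w => stepIntegral h n w - wienerIntegral h w) 2 γ :=
    ⟨(memLp_stepIntegral hγ h n).aestronglyMeasurable.sub hm, hn⟩
  have h2 := (memLp_stepIntegral hγ h n).sub h1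
  convert h2 using 1
  ext w
  simp

theorem tendsto_integral_stepIntegral_mul (hγ : IsWienerMeasure γ) (hh : h ∈ CameronMartin)
    (hk : k ∈ CameronMartin) :
    Tendsto (fun n => ∫ w, stepIntegral h n w * stepIntegral k n w ∂γ) atTop
      (𝓝 (∫ w, wienerIntegral h w * wienerIntegral k w ∂γ)) :=
  tendsto_integral_mul_of_tendsto_eLpNorm (memLp_stepIntegral hγ h) (memLp_stepIntegral hγ k)
    (memLp_two_wienerIntegral hγ hh) (memLp_two_wienerIntegral hγ hk)
    (tendsto_eLpNorm_stepIntegral hγ hh) (tendsto_eLpNorm_stepIntegral hγ hk)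

/-- At a Cameron--Martin path the limit exists, and equals the covariance of the integrals. -/
theorem tendsto_stepIntegral_cameronMartin (hγ : IsWienerMeasure γ) (hh : h ∈ CameronMartin)
    (hk : k ∈ CameronMartin) :
    Tendsto (fun n => stepIntegral h n k) atTop
      (𝓝 (∫ w, wienerIntegral h w * wienerIntegral k w ∂γ)) := by
  refine (tendsto_integral_stepIntegral_mul hγ hh hk).congr fun n => ?_
  exact integral_stepIntegral_mul_stepIntegral hγ hk h le_rfl

theorem isGaussianProcess_wienerIntegral (hγ : IsWienerMeasure γ) :
    IsGaussianProcess (fun (h : CameronMartin) w => wienerIntegral h w) γ :=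
  isGaussianProcess_of_tendsto_ae
    (fun n => (isGaussianProcess_stepIntegral hγ n).restrict CameronMartin)
    (fun n h => integral_stepIntegral hγ h n)
    (fun h k => tendsto_integral_stepIntegral_mul hγ h.2 k.2)
    (fun h => ae_tendsto_stepIntegral hγ h.2)

theorem integral_wienerIntegral (hγ : IsWienerMeasure γ) (hh : h ∈ CameronMartin) :
    ∫ w, wienerIntegral h w ∂γ = 0 := by
  have := hγ.isProbabilityMeasure
  have h1 := tendsto_integral_mul_of_tendsto_eLpNorm (memLp_stepIntegral hγ h)
    (fun _ => memLp_const (1 : ℝ)) (memLp_two_wienerIntegral hγ hh) (memLp_const (1 : ℝ))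
    (tendsto_eLpNorm_stepIntegral hγ hh) (by simp)
  simp only [mul_one, integral_stepIntegral hγ] at h1
  exact tendsto_nhds_unique h1 tendsto_const_nhds

/-! ### Directional derivatives and the duality formula -/

/-- The rate of change of `[h]` along `θ` at `w`: it is `⟨h, θ⟩` at the paths where the limit
defining `[h]` exists, and zero at the others. -/
theorem exists_wienerIntegral_add_smul (hγ : IsWienerMeasure γ) (hh : h ∈ CameronMartin)
    (hθ : θ ∈ CameronMartin) (w : PathSpace) :
    ∃ c : ℝ, (∀ ε : ℝ, wienerIntegral h (w + ε • θ) = wienerIntegral h w + ε * c) ∧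
      ((∃ L, Tendsto (fun n => stepIntegral h n w) atTop (𝓝 L)) →
        c = ∫ w, wienerIntegral h w * wienerIntegral θ w ∂γ) := by
  have hlim := tendsto_stepIntegral_cameronMartin hγ hh hθ
  by_cases hL : ∃ L, Tendsto (fun n => stepIntegral h n w) atTop (𝓝 L)
  · refine ⟨_, fun ε => ?_, fun _ => rfl⟩
    have h1 := (tendsto_wienerIntegral hL).add (hlim.const_mul ε)
    simp_rw [← stepIntegral_add_smul] at h1
    exact tendsto_nhds_unique (tendsto_wienerIntegral ⟨_, h1⟩) h1
  · refine ⟨0, fun ε => ?_, fun hL' => absurd hL' hL⟩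
    -- The set of convergence is invariant under translation by `ε • θ`, so the default value `0`
    -- persists along the whole line.
    have hL' : ¬ ∃ L, Tendsto (fun n => stepIntegral h n (w + ε • θ)) atTop (𝓝 L) := by
      rintro ⟨L, hL'⟩
      refine hL ⟨_, (hL'.sub (hlim.const_mul ε)).congr fun n => ?_⟩
      rw [stepIntegral_add_smul, add_sub_cancel_right]
    rw [wienerIntegral, wienerIntegral, dif_neg hL, dif_neg hL', mul_zero, add_zero]

theorem memLp_eval_wienerIntegral (hγ : IsWienerMeasure γ) {ι : Type*} {H : ι → PathSpace}
    (hH : ∀ i, H i ∈ CameronMartin) (p : MvPolynomial ι ℝ) {r : ENNReal} (hr : r ≠ ⊤) :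
    MemLp (fun w => MvPolynomial.eval (fun i => wienerIntegral (H i) w) p) r γ := by
  have := hγ.isProbabilityMeasure
  exact memLp_eval_mvPolynomial (fun i s hs =>
    ((isGaussianProcess_wienerIntegral hγ).hasGaussianLaw_eval ⟨H i, hH i⟩).memLp hs) p r hr

section Polynomial

variable {ι : Type*} [Fintype ι] {H : ι → PathSpace}

theorem lineDifferentiableAt_eval (hγ : IsWienerMeasure γ) (hH : ∀ i, H i ∈ CameronMartin)
    (hθ : θ ∈ CameronMartin) (p : MvPolynomial ι ℝ) (w : PathSpace) :
    LineDifferentiableAt ℝ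
      (fun w => MvPolynomial.eval (fun i => wienerIntegral (H i) w) p) w θ := by
  choose c hc _ using fun i => exists_wienerIntegral_add_smul hγ (hH i) hθ w
  unfold LineDifferentiableAt
  simp_rw [hc]
  exact (MvPolynomial.hasDerivAt_eval_add_mul p _ c 0).differentiableAt

/-- Almost every path lies in the convergence sets of all the finitely many `H i`, where the rates
of change are the constant covariances with `[θ]`. -/
theorem D_eval_ae (hγ : IsWienerMeasure γ) (hH : ∀ i, H i ∈ CameronMartin)
    (hθ : θ ∈ CameronMartin) (p : MvPolynomial ι ℝ) :
    D θ (fun w => MvPolynomial.eval (fun i => wienerIntegral (H i) w) p) =ᵐ[γ]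
      fun w => ∑ i, (∫ w, wienerIntegral θ w * wienerIntegral (H i) w ∂γ) *
        MvPolynomial.eval (fun i => wienerIntegral (H i) w) (MvPolynomial.pderiv i p) := by
  have hall : ∀ᵐ w ∂γ, ∀ i, Tendsto (fun n => stepIntegral (H i) n w) atTop
      (𝓝 (wienerIntegral (H i) w)) := ae_all_iff.2 fun i => ae_tendsto_stepIntegral hγ (hH i)
  filter_upwards [hall] with w hw
  choose c hc hc' using fun i => exists_wienerIntegral_add_smul hγ (hH i) hθ w
  rw [D, lineDeriv]
  simp_rw [hc]
  rw [(MvPolynomial.hasDerivAt_eval_add_mul p _ c 0).deriv]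
  simp only [zero_mul, add_zero]
  refine Finset.sum_congr rfl fun i _ => ?_
  rw [hc' i ⟨_, hw i⟩]
  simp_rw [mul_comm (wienerIntegral θ _)]

theorem memLp_D_eval (hγ : IsWienerMeasure γ) (hH : ∀ i, H i ∈ CameronMartin)
    (hθ : θ ∈ CameronMartin) (p : MvPolynomial ι ℝ) :
    MemLp (D θ fun w => MvPolynomial.eval (fun i => wienerIntegral (H i) w) p) 2 γ :=
  (memLp_congr_ae (D_eval_ae hγ hH hθ p)).2 <|
    memLp_finsetSum _ fun _ _ => (memLp_eval_wienerIntegral hγ hH _ (by norm_num)).const_mul _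

theorem duality_eval (hγ : IsWienerMeasure γ) (hH : ∀ i, H i ∈ CameronMartin)
    (hθ : θ ∈ CameronMartin) (p q : MvPolynomial ι ℝ) {F G : PathSpace → ℝ}
    (hF : F = fun w => MvPolynomial.eval (fun i => wienerIntegral (H i) w) p)
    (hG : G = fun w => MvPolynomial.eval (fun i => wienerIntegral (H i) w) q) :
    Integrable (fun w => D θ F w * G w) γ ∧ Integrable (fun w => F w * Dstar θ G w) γ ∧
      ∫ w, D θ F w * G w ∂γ = ∫ w, F w * Dstar θ G w ∂γ := by
  have := hγ.isProbabilityMeasure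
  have hDF := memLp_D_eval hγ hH hθ p
  have hDG := memLp_D_eval hγ hH hθ q
  have hF2 := memLp_eval_wienerIntegral hγ hH p (r := 2) (by norm_num)
  have hG2 := memLp_eval_wienerIntegral hγ hH q (r := 2) (by norm_num)
  have hFG2 := memLp_eval_wienerIntegral hγ hH (p * q) (r := 2) (by norm_num)
  simp only [map_mul] at hFG2
  rw [← hF] at hDF hF2
  rw [← hG] at hDG hG2
  have i1 : Integrable (fun w => D θ F w * G w) γ := hDF.integrable_mul hG2
  have i2 : Integrable (fun w => F w * D θ G w) γ := hF2.integrable_mul hDG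
  have i3 : Integrable (fun w => wienerIntegral θ w * (F w * G w)) γ := by
    rw [hF, hG]
    exact (memLp_two_wienerIntegral hγ hθ).integrable_mul hFG2
  have hstar : (fun w => F w * Dstar θ G w)
      = fun w => wienerIntegral θ w * (F w * G w) - F w * D θ G w := by
    ext w
    rw [Dstar]
    ring
  refine ⟨i1, hstar ▸ i3.sub i2, ?_⟩
  -- The claim is now `E[D_θ F · G + F · D_θ G] = E[[θ] F G]`: integration by parts for `p * q`,
  -- matched with the left side by the Leibniz rule for `pderiv`.
  rw [hstar, integral_sub i3 i2, eq_sub_iff_add_eq, ← integral_add i1 i2]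
  have hgauss := (isGaussianProcess_wienerIntegral hγ).integral_mul_eval
    (fun h => integral_wienerIntegral hγ h.2) ⟨θ, hθ⟩ (fun i => ⟨H i, hH i⟩) (p * q)
  simp only [map_mul] at hgauss
  simp only [hF, hG]
  rw [hgauss]
  simp_rw [← integral_const_mul]
  rw [← integral_finsetSum _ fun i _ =>
    ((memLp_eval_wienerIntegral hγ hH _ (r := 1) (by norm_num)).integrable le_rfl).const_mul _]
  refine integral_congr_ae ?_
  filter_upwards [D_eval_ae hγ hH hθ p, D_eval_ae hγ hH hθ q] with w h1 h2
  rw [h1, h2, Finset.sum_mul, Finset.mul_sum, ← Finset.sum_add_distrib]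
  refine Finset.sum_congr rfl fun i _ => ?_
  simp only [Derivation.leibniz, smul_eq_mul, map_add, map_mul]
  ring

end Polynomial

/-- Two polynomial functionals are polynomials in a common family of Wiener integrals. -/
theorem exists_common_family {F G : PathSpace → ℝ} (hF : F ∈ PolynomialFunctional)
    (hG : G ∈ PolynomialFunctional) :
    ∃ (n m : ℕ) (H : Fin n ⊕ Fin m → PathSpace) (p q : MvPolynomial (Fin n ⊕ Fin m) ℝ),
      (∀ i, H i ∈ CameronMartin) ∧
      (F = fun w => MvPolynomial.eval (fun i => wienerIntegral (H i) w) p) ∧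
      (G = fun w => MvPolynomial.eval (fun i => wienerIntegral (H i) w) q) := by
  obtain ⟨n, h, p, hh, hFp⟩ := hF
  obtain ⟨m, k, q, hk, hGq⟩ := hG
  -- The disjoint union of the two families suffices: repeated or dependent paths are harmless, as
  -- no nondegeneracy is needed.
  refine ⟨n, m, Sum.elim h k, MvPolynomial.rename Sum.inl p, MvPolynomial.rename Sum.inr q,
    ?_, ?_, ?_⟩
  · rintro (i | i)
    · exact hh i
    · exact hk i
  · ext w
    rw [hFp, MvPolynomial.eval_rename]
    rfl
  · ext w
    rw [hGq, MvPolynomial.eval_rename]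
    rfl

end Wiener

theorem mainTheorem8 (γ : Measure Wiener.PathSpace) (hγ : Wiener.IsWienerMeasure γ) :
    -- the pathwise limits defining `[h]` exist almost surely, and `[h]` is the `L²` Wiener integral
    (∀ h ∈ Wiener.CameronMartin,
      (∀ᵐ w ∂γ, Tendsto (fun n => Wiener.stepIntegral h n w) atTop
        (𝓝 (Wiener.wienerIntegral h w))) ∧
      Tendsto (fun n => eLpNorm
        (fun w => Wiener.stepIntegral h n w - Wiener.wienerIntegral h w) 2 γ) atTop (𝓝 0)) ∧
    -- the duality formula, with the derivatives and the expectations well defined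
    (∀ θ ∈ Wiener.CameronMartin,
      ∀ F ∈ Wiener.PolynomialFunctional, ∀ G ∈ Wiener.PolynomialFunctional,
        (∀ w, LineDifferentiableAt ℝ F w θ) ∧
        (∀ w, LineDifferentiableAt ℝ G w θ) ∧
        Integrable (fun w => Wiener.D θ F w * G w) γ ∧
        Integrable (fun w => F w * Wiener.Dstar θ G w) γ ∧
        ∫ w, Wiener.D θ F w * G w ∂γ = ∫ w, F w * Wiener.Dstar θ G w ∂γ) := by
  refine ⟨fun h hh => ⟨Wiener.ae_tendsto_stepIntegral hγ hh,
    Wiener.tendsto_eLpNorm_stepIntegral hγ hh⟩, fun θ hθ F hF G hG => ?_⟩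
  obtain ⟨n, m, H, p, q, hH, hFp, hGq⟩ := Wiener.exists_common_family hF hG
  refine ⟨fun w => ?_, fun w => ?_, Wiener.duality_eval hγ hH hθ p q hFp hGq⟩
  · rw [hFp]
    exact Wiener.lineDifferentiableAt_eval hγ hH hθ p w
  · rw [hGq]
    exact Wiener.lineDifferentiableAt_eval hγ hH hθ q w
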